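/- Let $G$ be a compact connected (real, finite-dimensional) Lie group with identity $e$ and Lie algebra $\mathfrak g\cong T_eG$ of left-invariant vector fields, and let $X_1,\dots,X_m\in\mathfrak g$ generate $\mathfrak g$ as a Lie algebra. Let $(x_r,u_1^r,\dots,u_m^r)$ be a $T$-periodic trajectory ($T>0$) of the system $x'=\sum_{k=1}^m u_kX_k(x)$; that is, $u_1^r,\dots,u_m^r:\mathbb R\to\mathbb R$ are smooth, $x_r:\mathbb R\to G$ satisfies $x_r'(t)=\sum_{k=1}^m u_k^r(t)X_k(x_r(t))$ for all $t\in\mathbb R$, and $x_r,u_1^r,\dots,u_m^r$ are all $T$-periodic. For $x\in G$ let $\mathrm{Ad}(x):\mathfrak g\to\mathfrak g$ be the differential at $e$ of $y\mapsto xyx^{-1}$, and put $V(x)=\mathrm{tr}\,\mathrm{Ad}(x)$. Define the time-dependent vector field $W$ on $G$ by $$W(t,w)=\sum_{k=1}^m a_k(t,w)\,\bigl(\mathrm{Ad}(x_r(t))X_k\bigr)(w),\qquad a_k(t,w)=\mathrm dV_w\bigl((\mathrm{Ad}(x_r(t))X_k)(w)\bigr),$$ where $\mathrm{Ad}(x_r(t))X_k\in\mathfrak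 g$ is regarded as a left-invariant vector field. A point $w\in G$ is a critical point of $W$ if $W(t,w)=0$ for all $t\in\mathbb R$. A critical point $w$ is a local attractor of $W$ if it has a neighborhood $U\subset G$ such that for every $(t_0,w_0)\in\mathbb R\times U$ the unique integral curve $\gamma:\mathbb R\to G$ of $W$ with $\gamma(t_0)=w_0$ satisfies $\lim_{t\to\infty}\gamma(t)=w$. Then every element of the center $Z(G)$ of $G$ is a critical point of $W$. Moreover, if $e$ is a local attractor of $W$, then $G$ is semisimple (that is, its Lie algebra $\mathfrak g$ is semisimple). -/

import Mathlib

open scoped Manifold ContDiff Topology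

noncomputable section

namespace PeriodicTracking

section TimeDependentFields

variable {E : Type*} [NormedAddCommGroup E] [NormedSpace ℝ E]
  {H : Type*} [TopologicalSpace H] {I : ModelWithCorners ℝ E H}
  {M : Type*} [TopologicalSpace M] [ChartedSpace H M]

/-- `γ : ℝ → M` is a (global) integral curve of the time-dependent vector field `Y`:
`γ'(t) = Y(t, γ(t))` for all `t`. -/
def IsIntegralCurve (γ : ℝ → M) (Y : ℝ → (x : M) → TangentSpace I x) : Prop :=
  ∀ t : ℝ, HasMFDerivAt 𝓘(ℝ, ℝ) I γ t ((1 : ℝ →L[ℝ] ℝ).smulRight (Y t (γ t)))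

/-- `w` is a critical point of the time-dependent vector field `Y`: `Y(t, w) = 0` for all `t`. -/
def IsCriticalPoint (Y : ℝ → (x : M) → TangentSpace I x) (w : M) : Prop :=
  ∀ t : ℝ, Y t w = 0

/-- `w` is a local attractor of the time-dependent vector field `Y`: it is a critical point, and
it has a neighborhood `U` such that, for every `(t₀, w₀) ∈ ℝ × U`, the integral curve `γ : ℝ → M`
of `Y` with `γ(t₀) = w₀` (which exists and is unique if `Y` is smooth and `M` is compact)
converges to `w` as `t → ∞`. -/
def IsLocalAttractor (Y : ℝ → (x : M) → TangentSpace I x) (w : M) : Prop :=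
  IsCriticalPoint Y w ∧
    ∃ U ∈ 𝓝 w, ∀ t₀ : ℝ, ∀ w₀ ∈ U, ∀ γ : ℝ → M,
      IsIntegralCurve γ Y → γ t₀ = w₀ → Filter.Tendsto γ Filter.atTop (𝓝 w)

end TimeDependentFields

section LieGroups

variable {E : Type*} [NormedAddCommGroup E] [NormedSpace ℝ E]
  {H : Type*} [TopologicalSpace H] {I : ModelWithCorners ℝ E H}
  {G : Type*} [TopologicalSpace G] [ChartedSpace H G] [Group G] {m : ℕ}

/-- The Lie algebra structure on `T_e G` requires only three derivatives. -/
instance instLieGroupMinSmoothness [LieGroup I ∞ G] : LieGroup I (minSmoothness ℝ 3) G :=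
  LieGroup.of_le (n := ∞) (by simpa using (ENat.LEInfty.out : (3 : ℕ∞ω) ≤ ∞))

/-- `X₁, …, X_m` is bracket-generating: the Lie algebra generated by them (equivalently, by their
linear span) is the whole Lie algebra of `G`. -/
def IsBracketGenerating [CompleteSpace E] [LieGroup I ∞ G]
    (X : Fin m → GroupLieAlgebra I G) : Prop :=
  LieSubalgebra.lieSpan ℝ (GroupLieAlgebra I G) (Set.range X) = ⊤

variable (I) in
/-- The adjoint map: `Ad(x)` is the differential at `e` of the conjugation `y ↦ x y x⁻¹`
(the target is the tangent space at `x e x⁻¹ = e`). -/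
def Ad (x : G) : GroupLieAlgebra I G →L[ℝ] GroupLieAlgebra I G :=
  mfderiv I I (fun y : G => x * y * x⁻¹) 1

variable (I) in
/-- The Lyapunov-like function `V(x) = tr Ad(x)`. -/
def V (x : G) : ℝ :=
  LinearMap.trace ℝ (GroupLieAlgebra I G) (Ad I x : GroupLieAlgebra I G →ₗ[ℝ] GroupLieAlgebra I G)

/-- The time-dependent vector field `(t, x) ↦ ∑ₖ uₖ(t) Xₖ(x)` of the driftless system with
controls `u`, where `Xₖ` is regarded as a left-invariant vector field. -/
def controlledField (X : Fin m → GroupLieAlgebra I G) (u : Fin m → ℝ → ℝ)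
    (t : ℝ) (x : G) : TangentSpace I x :=
  ∑ k, u k t • mulInvariantVectorField (X k) x

/-- `(x, u₁, …, u_m)` is a (smooth) `T`-periodic trajectory of the system
`x' = ∑ₖ uₖ Xₖ(x)`. -/
structure IsPeriodicTrajectory (X : Fin m → GroupLieAlgebra I G) (T : ℝ)
    (x : ℝ → G) (u : Fin m → ℝ → ℝ) : Prop where
  period_pos : 0 < T
  contDiff_control : ∀ k, ContDiff ℝ ∞ (u k)
  isIntegralCurve : IsIntegralCurve x (controlledField X u)
  periodic_curve : Function.Periodic x T
  periodic_control : ∀ k, Function.Periodic (u k) T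

/-- The left-invariant vector field `Ad(x_r(t)) Xₖ`, at the point `w`. -/
def adField (X : Fin m → GroupLieAlgebra I G) (xr : ℝ → G) (k : Fin m)
    (t : ℝ) (w : G) : TangentSpace I w :=
  mulInvariantVectorField (Ad I (xr t) (X k)) w

/-- The feedback coefficients `aₖ(t, w) = dV(Ad(x_r(t)) Xₖ(w))`. -/
def a (X : Fin m → GroupLieAlgebra I G) (xr : ℝ → G) (k : Fin m) (t : ℝ) (w : G) : ℝ :=
  mvfderiv I (V I : G → ℝ) w (adField X xr k t w)

/-- The auxiliary vector field `W(t, w) = ∑ₖ aₖ(t, w) Ad(x_r(t)) Xₖ(w)`. -/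
def W (X : Fin m → GroupLieAlgebra I G) (xr : ℝ → G) (t : ℝ) (w : G) : TangentSpace I w :=
  ∑ k, a X xr k t w • adField X xr k t w

end LieGroups

end PeriodicTracking

end

/-! Averaging over Haar measure gives an `Ad`-invariant inner product on the Lie algebra
(`exists_Ad_invariant_form`). Each `Ad x` is then an isometry, so `V` is at most the dimension, with
equality wherever `Ad x` is the identity. Such points, in particular the central ones, are maxima of
`V`; there `dV` vanishes, and with it every coefficient of `W` (`isCriticalPoint_W_of_Ad_eq_id`).

A local attractor is isolated among critical points, since constant curves at critical points are
integral curves. If some `z ≠ 0` were central in the Lie algebra, `Ad` would stay the identity along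
the integral curve of `z` through `e`, giving critical points other than `e` arbitrarily close to it
(`exists_ne_one_Ad_eq_id`). So an attracting identity forces a trivial center, and a positive
definite invariant form then makes the Lie algebra semisimple (`isSemisimple_of_invariant_form`).

The link between group and algebra is that the differential of `Ad` at `e` is the bracket
(`mfderiv_adOrbit_one`), obtained from second derivatives of the group law in a chart. -/

open scoped Manifold ContDiff Topology
open Set Filter VectorField MeasureTheory Module

/-! ### The adjoint map: local calculus, multiplicativity, smoothness. -/

namespace PeriodicTracking

/-- The derivative at the identity of the adjoint map of a local group law, in terms of the mixed
second derivatives of the group law. -/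
theorem fderiv_adjoint_of_contDiffAt {E : Type*} [NormedAddCommGroup E] [NormedSpace ℝ E]
    {μ : E × E → E} {p : E} (hμ : ContDiffAt ℝ 2 μ (p, p))
    (hid : ∀ᶠ b in 𝓝 p, μ (b, p) = b)
    {A : E → E} (hA : DifferentiableAt ℝ A p)
    (w v : E) (hw : A p = w)
    (hAμ : ∀ᶠ a in 𝓝 p, fderiv ℝ (fun b ↦ μ (a, b)) p w = fderiv ℝ (fun b ↦ μ (b, a)) p (A a)) :
    fderiv ℝ A p v = fderiv ℝ (fun a ↦ fderiv ℝ (fun b ↦ μ (a, b)) p w) p v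
      - fderiv ℝ (fun a ↦ fderiv ℝ (fun b ↦ μ (a, b)) p v) p w := by
  have hd : ∀ᶠ q in 𝓝 (p, p), DifferentiableAt ℝ μ q := by
    filter_upwards [hμ.eventually (by simp)] with q hq
    exact hq.differentiableAt (by simp)
  have h2 : HasFDerivAt (fderiv ℝ μ) (fderiv ℝ (fderiv ℝ μ) (p, p)) (p, p) :=
    ((hμ.fderiv_right (m := 1) (by norm_num)).differentiableAt (by simp)).hasFDerivAt
  have hsymm := hμ.isSymmSndFDerivAt (by simp)
  set S := fderiv ℝ (fderiv ℝ μ) (p, p) with hS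
  have hr (u : E) : HasFDerivAt (fun a : E ↦ fderiv ℝ μ (a, p) (0, u))
      ((S.flip (0, u)).comp (ContinuousLinearMap.inl ℝ E E)) p := by
    have h1 : HasFDerivAt (fun a : E ↦ (a, p)) (ContinuousLinearMap.inl ℝ E E) p :=
      hasFDerivAt_prodMk_left p p
    have := (HasFDerivAt.comp (g := fderiv ℝ μ) (f := fun a : E ↦ (a, p)) p h2 h1).clm_apply (hasFDerivAt_const ((0 : E), u) p)
    refine this.congr_fderiv ?_
    ext; simp
  have hl : HasFDerivAt (fun a : E ↦ fderiv ℝ μ (p, a))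
      (S.comp (ContinuousLinearMap.inr ℝ E E)) p :=
    HasFDerivAt.comp (g := fderiv ℝ μ) (f := fun a : E ↦ (p, a)) p h2 (hasFDerivAt_prodMk_right p p)
  have er : ∀ᶠ a in 𝓝 p, ∀ u, fderiv ℝ (fun b ↦ μ (a, b)) p u = fderiv ℝ μ (a, p) (0, u) := by
    have ht : Tendsto (fun a : E ↦ (a, p)) (𝓝 p) (𝓝 (p, p)) := by
      apply Continuous.tendsto' (by fun_prop) _ _ rfl
    filter_upwards [ht.eventually hd] with a ha u
    have := HasFDerivAt.comp (g := μ) (f := fun b : E ↦ (a, b)) p ha.hasFDerivAt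
      (hasFDerivAt_prodMk_right a p)
    have e : fderiv ℝ (fun b ↦ μ (a, b)) p = _ := this.fderiv
    rw [e]; simp
  have el : ∀ᶠ a in 𝓝 p, ∀ u, fderiv ℝ (fun b ↦ μ (b, a)) p u = fderiv ℝ μ (p, a) (u, 0) := by
    have ht : Tendsto (fun a : E ↦ (p, a)) (𝓝 p) (𝓝 (p, p)) := by
      apply Continuous.tendsto' (by fun_prop) _ _ rfl
    filter_upwards [ht.eventually hd] with a ha u
    have := HasFDerivAt.comp (g := μ) (f := fun b : E ↦ (b, a)) p ha.hasFDerivAt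
      (hasFDerivAt_prodMk_left p a)
    have e : fderiv ℝ (fun b ↦ μ (b, a)) p = _ := this.fderiv
    rw [e]; simp
  have hone (u : E) : fderiv ℝ μ (p, p) (u, 0) = u := by
    rw [← el.self_of_nhds u]
    have : fderiv ℝ (fun b ↦ μ (b, p)) p = fderiv ℝ id p := EventuallyEq.fderiv_eq hid
    simp [this]
  have e1 (u : E) : fderiv ℝ (fun a ↦ fderiv ℝ (fun b ↦ μ (a, b)) p u) p =
      (S.flip (0, u)).comp (ContinuousLinearMap.inl ℝ E E) := by
    rw [← (hr u).fderiv]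
    exact EventuallyEq.fderiv_eq (er.mono fun a ha ↦ ha u)
  have hinl : HasFDerivAt (fun a ↦ (A a, (0 : E)))
      ((fderiv ℝ A p).prod 0) p := hA.hasFDerivAt.prodMk (hasFDerivAt_const _ _)
  have h3 := hl.clm_apply hinl
  -- Differentiating this identity at `p` along `v` gives `S (v, 0) (0, w) = S (0, v) (w, 0) + A'
  -- v`; symmetry of `S` turns the middle term into the second mixed derivative of the claim.
  have e2 : (fun a : E ↦ fderiv ℝ μ (a, p) (0, w)) =ᶠ[𝓝 p]
      fun a ↦ fderiv ℝ μ (p, a) (A a, 0) := by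
    filter_upwards [hAμ, er, el] with a h h' h''
    rw [← h', ← h'', h]
  have h4 := congrArg (fun L : E →L[ℝ] E ↦ L v) (((hr w).congr_of_eventuallyEq e2.symm).unique h3)
  simp only [ContinuousLinearMap.comp_apply, ContinuousLinearMap.flip_apply,
    ContinuousLinearMap.inl_apply, ContinuousLinearMap.inr_apply, add_apply,
    ContinuousLinearMap.prod_apply, hw, zero_apply, hone] at h4
  rw [e1, e1]
  simp only [ContinuousLinearMap.comp_apply, ContinuousLinearMap.flip_apply,
    ContinuousLinearMap.inl_apply]
  rw [h4, hsymm.eq (w, 0) (0, v)]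
  abel

section

variable {E : Type*} [NormedAddCommGroup E] [NormedSpace ℝ E]
  {H : Type*} [TopologicalSpace H] {I : ModelWithCorners ℝ E H}
  {G : Type*} [TopologicalSpace G] [ChartedSpace H G] [Group G]

/-- The chain rule, with the derivatives seen as linear maps between the model spaces. -/
theorem mfderiv_comp_apply_of_eq {E' E'' H' H'' M M' M'' : Type*}
    [NormedAddCommGroup E'] [NormedSpace ℝ E'] [TopologicalSpace H'] {I' : ModelWithCorners ℝ E' H'}
    [NormedAddCommGroup E''] [NormedSpace ℝ E''] [TopologicalSpace H'']
    {I'' : ModelWithCorners ℝ E'' H''} [TopologicalSpace M] [ChartedSpace H M]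
    [TopologicalSpace M'] [ChartedSpace H' M'] [TopologicalSpace M''] [ChartedSpace H'' M'']
    {g : M' → M''} {f : M → M'} {x : M} {y : M'} (hg : MDifferentiableAt I' I'' g y)
    (hf : MDifferentiableAt I I' f x) (h : f x = y) (v : E) :
    (mfderiv I I'' (g ∘ f) x v : E'') = mfderiv I' I'' g y (mfderiv I I' f x v : E') := by
  subst h
  rw [mfderiv_comp x hg hf]
  rfl

variable (I) in
theorem Ad_one : Ad I (1 : G) = ContinuousLinearMap.id ℝ _ := by
  have : (fun y : G ↦ 1 * y * 1⁻¹) = id := by ext; simp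
  rw [Ad, this]
  exact mfderiv_id

variable [LieGroup I ∞ G]

theorem mdifferentiableAt_mul_left (g x : G) : MDifferentiableAt I I (fun y : G ↦ g * y) x :=
  (contMDiff_mul_left (n := ∞)).mdifferentiable (by simp) x

theorem mdifferentiableAt_mul_right (g x : G) : MDifferentiableAt I I (fun y : G ↦ y * g) x :=
  (contMDiff_mul_right (n := ∞)).mdifferentiable (by simp) x

theorem mdifferentiableAt_conj (g x : G) : MDifferentiableAt I I (fun y : G ↦ g * y * g⁻¹) x :=
  (mdifferentiableAt_mul_right g⁻¹ (g * x)).comp x (mdifferentiableAt_mul_left g x)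

variable (I) in
theorem Ad_mul_apply (x y : G) (v : GroupLieAlgebra I G) :
    Ad I (x * y) v = Ad I x (Ad I y v) := by
  have h : (fun z : G ↦ x * y * z * (x * y)⁻¹) =
      (fun z ↦ x * z * x⁻¹) ∘ (fun z ↦ y * z * y⁻¹) := by
    ext; simp [mul_assoc]
  rw [Ad, h]
  exact mfderiv_comp_apply_of_eq (mdifferentiableAt_conj (I := I) x 1)
    (mdifferentiableAt_conj (I := I) y 1) (by simp) v

/-- Left translation is right translation after the adjoint map. -/
theorem mulInvariantVectorField_eq_mfderiv_mul_right (x : G) (w : GroupLieAlgebra I G) :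
    (mulInvariantVectorField w x : E) = mfderiv I I (fun y : G ↦ y * x) 1 (Ad I x w) := by
  have h : (fun z : G ↦ x * z) = (fun z ↦ z * x) ∘ (fun z ↦ x * z * x⁻¹) := by
    ext; simp [mul_assoc]
  rw [mulInvariantVectorField, h]
  exact mfderiv_comp_apply_of_eq (mdifferentiableAt_mul_right (I := I) x 1)
    (mdifferentiableAt_conj (I := I) x 1) (by simp) w

variable (I) in
/-- The adjoint orbit map of a vector, with values in the model space. -/
noncomputable def adOrbit (w : GroupLieAlgebra I G) (x : G) : E := Ad I x w

variable (I) in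
theorem contMDiff_adOrbit (w : GroupLieAlgebra I G) :
    ContMDiff I 𝓘(ℝ, E) ∞ (adOrbit I (G := G) w) := by
  intro x₀
  have h : ContMDiffAt (I.prod I) I ∞ (Function.uncurry fun (x : G) (y : G) ↦ x * y * x⁻¹)
      (x₀, 1) := by
    apply ContMDiff.contMDiffAt
    exact (contMDiff_fst.mul contMDiff_snd).mul (contMDiff_fst.inv)
  obtain ⟨u, hu⟩ : ∃ u : E, u = w := ⟨w, rfl⟩
  have h1 := (ContMDiffAt.mfderiv (fun (x : G) (y : G) ↦ x * y * x⁻¹) (fun _ ↦ (1 : G)) h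
    (contMDiffAt_const (n := ∞)) (m := ∞) (by simp)).clm_apply (contMDiffAt_const (c := u))
  convert h1 using 1
  ext x
  -- The base point `x * 1 * x⁻¹` is only propositionally `1`, so the coordinate changes are shown
  -- trivial for any points equal to `1`.
  have hc (a b : G) (v : E) (ha : a = 1) (hb : b = 1) :
      (tangentBundleCore I G).coordChange (achart H a) (achart H b) a v = v := by
    subst ha hb
    exact (tangentBundleCore I G).coordChange_self (achart H 1) 1 (mem_chart_source H 1) v
  have h2 := congrArg (fun L : E →L[ℝ] E ↦ L u) (inTangentCoordinates_eq (I := I) (I' := I)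
    (fun _ : G ↦ (1 : G)) (fun x ↦ x * 1 * x⁻¹)
    (fun x ↦ mfderiv I I (fun y ↦ x * y * x⁻¹) 1) (x₀ := x₀) (x := x) (by simp) (by simp))
  refine Eq.trans ?_ h2.symm
  refine ((hc _ _ _ (by simp) (by simp)).trans ?_).symm
  refine (congrArg (fun L : E ↦ (mfderiv I I (fun y ↦ x * y * x⁻¹) 1 L : E))
    (hc 1 1 u rfl rfl)).trans ?_
  rw [hu]
  rfl

end
end PeriodicTracking

/-! ### The group law in a chart, and the differential of `Ad` as the bracket. -/

namespace PeriodicTracking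
section

variable {E : Type*} [NormedAddCommGroup E] [NormedSpace ℝ E]
  {H : Type*} [TopologicalSpace H] {I : ModelWithCorners ℝ E H}
  {G : Type*} [TopologicalSpace G] [ChartedSpace H G]

/-- The derivative at the chart point of the expression in the chart at `y` of a self-map of a
manifold. -/
theorem fderiv_extChartAt_comp_symm [IsManifold I 1 G] [I.Boundaryless] {f : G → G} {x y : G}
    (hf : MDifferentiableAt I I f y) (hx : f y = x) (hxs : x ∈ (chartAt H y).source) (u : E) :
    fderiv ℝ (fun b ↦ extChartAt I y (f ((extChartAt I y).symm b))) (extChartAt I y y) u =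
      mfderiv I 𝓘(ℝ, E) (extChartAt I y) x (mfderiv I I f y u : E) := by
  subst hx
  have h1 : MDifferentiableAt 𝓘(ℝ, E) I (extChartAt I y).symm (extChartAt I y y) := by
    have := mdifferentiableWithinAt_extChartAt_symm (I := I) (mem_extChartAt_target (I := I) y)
    rwa [I.range_eq_univ, mdifferentiableWithinAt_univ] at this
  have h2 : MDifferentiableAt I 𝓘(ℝ, E) (extChartAt I y ∘ f) y :=
    (mdifferentiableAt_extChartAt hxs).comp y hf
  have h3 : mfderiv 𝓘(ℝ, E) I (extChartAt I y).symm (extChartAt I y y) =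
      ContinuousLinearMap.id ℝ _ := by
    have := mfderivWithin_range_extChartAt_symm (I := I) (x := y)
    rwa [I.range_eq_univ, mfderivWithin_univ] at this
  have h4 := mfderiv_comp_of_eq (x := extChartAt I y y) h2 h1 (by simp)
  have h5 := mfderiv_comp y (mdifferentiableAt_extChartAt hxs) hf
  have h6 := congrArg (fun L : E →L[ℝ] E ↦ L u) h4
  rw [mfderiv_eq_fderiv] at h6
  refine h6.trans ?_
  change (mfderiv I 𝓘(ℝ, E) (extChartAt I y ∘ f) _) (mfderiv 𝓘(ℝ, E) I (extChartAt I y).symm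
    (extChartAt I y y) u) = _
  rw [h3]
  have h7 (z : G) (hz : z = y) : (mfderiv I 𝓘(ℝ, E) (extChartAt I y ∘ f) z u : E) =
      mfderiv I 𝓘(ℝ, E) (extChartAt I y) (f y) (mfderiv I I f y u : E) := by
    subst hz
    rw [h5]
    rfl
  exact h7 _ (by simp)

theorem inverse_mfderivWithin_extChartAt_symm [IsManifold I 1 G] {y : G} {a : E}
    (ha : a ∈ (extChartAt I y).target) :
    (mfderivWithin 𝓘(ℝ, E) I (extChartAt I y).symm (range I) a).inverse =
      mfderiv I 𝓘(ℝ, E) (extChartAt I y) ((extChartAt I y).symm a) :=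
  ContinuousLinearMap.inverse_eq (mfderivWithin_extChartAt_symm_comp_mfderiv_extChartAt ha)
    (mfderiv_extChartAt_comp_mfderivWithin_extChartAt_symm ha)

variable [Group G] [LieGroup I ∞ G] [I.Boundaryless]

variable (I G) in
/-- The group law in the chart at the identity. -/
noncomputable def chartMul (q : E × E) : E :=
  extChartAt I (1 : G) ((extChartAt I (1 : G)).symm q.1 * (extChartAt I (1 : G)).symm q.2)

variable (I G) in
theorem contDiffAt_chartMul :
    ContDiffAt ℝ ∞ (chartMul I G) (extChartAt I (1 : G) 1, extChartAt I (1 : G) 1) := by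
  have hs : ContMDiffAt 𝓘(ℝ, E) I ∞ (extChartAt I (1 : G)).symm (extChartAt I (1 : G) 1) :=
    (contMDiffOn_extChartAt_symm (1 : G)).contMDiffAt (extChartAt_target_mem_nhds (1 : G))
  rw [← contMDiffAt_iff_contDiffAt]
  have h1 : ContMDiffAt 𝓘(ℝ, E × E) I ∞ (fun q : E × E ↦ (extChartAt I (1 : G)).symm q.1)
      (extChartAt I (1 : G) 1, extChartAt I (1 : G) 1) :=
    ContMDiffAt.comp (g := (extChartAt I (1 : G)).symm) _ hs contDiffAt_fst.contMDiffAt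
  have h2 : ContMDiffAt 𝓘(ℝ, E × E) I ∞ (fun q : E × E ↦ (extChartAt I (1 : G)).symm q.2)
      (extChartAt I (1 : G) 1, extChartAt I (1 : G) 1) :=
    ContMDiffAt.comp (g := (extChartAt I (1 : G)).symm) _ hs contDiffAt_snd.contMDiffAt
  refine ContMDiffAt.comp_of_eq (g := extChartAt I (1 : G)) (y := 1) contMDiffAt_extChartAt
    (h1.mul h2) (by simp)

/-- Identifies a partial derivative of the group law with the chart expression of a left-invariant
field, so that brackets of such fields become second derivatives. -/
theorem fderiv_chartMul_right {a : E} (ha : a ∈ (extChartAt I (1 : G)).target) (u : E) :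
    fderiv ℝ (fun b ↦ chartMul I G (a, b)) (extChartAt I (1 : G) 1) u =
      mfderiv I 𝓘(ℝ, E) (extChartAt I (1 : G)) ((extChartAt I (1 : G)).symm a)
        (mulInvariantVectorField (I := I) (G := G) u ((extChartAt I (1 : G)).symm a)) :=
  have : IsManifold I 1 G := .of_le (n := ∞) (by simp)
  fderiv_extChartAt_comp_symm (f := fun y : G ↦ (extChartAt I (1 : G)).symm a * y)
    (mdifferentiableAt_mul_left _ _) (by simp)
    (by simpa using (extChartAt I (1 : G)).map_target ha) u

theorem fderiv_chartMul_left {a : E} (ha : a ∈ (extChartAt I (1 : G)).target) (u : E) :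
    fderiv ℝ (fun b ↦ chartMul I G (b, a)) (extChartAt I (1 : G) 1) u =
      mfderiv I 𝓘(ℝ, E) (extChartAt I (1 : G)) ((extChartAt I (1 : G)).symm a)
        (mfderiv I I (fun y : G ↦ y * (extChartAt I (1 : G)).symm a) 1 u : E) :=
  have : IsManifold I 1 G := .of_le (n := ∞) (by simp)
  fderiv_extChartAt_comp_symm (f := fun y : G ↦ y * (extChartAt I (1 : G)).symm a)
    (mdifferentiableAt_mul_right _ _) (by simp)
    (by simpa using (extChartAt I (1 : G)).map_target ha) u

omit [LieGroup I ∞ G] in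
variable (I G) in
theorem eventually_chartMul_one_right :
    ∀ᶠ b in 𝓝 (extChartAt I (1 : G) 1), chartMul I G (b, extChartAt I (1 : G) 1) = b := by
  filter_upwards [extChartAt_target_mem_nhds (I := I) (1 : G)] with b hb
  simpa [chartMul] using (extChartAt I (1 : G)).right_inv hb

omit [LieGroup I ∞ G] in
variable (I G) in
theorem eventually_chartMul_one_left :
    ∀ᶠ b in 𝓝 (extChartAt I (1 : G) 1), chartMul I G (extChartAt I (1 : G) 1, b) = b := by
  filter_upwards [extChartAt_target_mem_nhds (I := I) (1 : G)] with b hb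
  simpa [chartMul] using (extChartAt I (1 : G)).right_inv hb

/-- The Lie bracket of a Lie group is the antisymmetrized mixed second derivative of the group law
in a chart. -/
theorem mlieBracket_mulInvariantVectorField_one (v w : E) :
    mlieBracket I (mulInvariantVectorField (I := I) (G := G) v)
      (mulInvariantVectorField (I := I) (G := G) w) 1 =
      fderiv ℝ (fun a ↦ fderiv ℝ (fun b ↦ chartMul I G (a, b)) (extChartAt I (1 : G) 1) w)
        (extChartAt I (1 : G) 1) v -
      fderiv ℝ (fun a ↦ fderiv ℝ (fun b ↦ chartMul I G (a, b)) (extChartAt I (1 : G) 1) v)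
        (extChartAt I (1 : G) 1) w := by
  have : IsManifold I 1 G := .of_le (n := ∞) (by simp)
  set p := extChartAt I (1 : G) 1 with hpdef
  -- The bracket is computed on chart pullbacks of the fields, which near `p` are partial
  -- derivatives of `chartMul`.
  have h (u : E) : (mpullbackWithin 𝓘(ℝ, E) I (extChartAt I (1 : G)).symm
      (mulInvariantVectorField (I := I) (G := G) u) (range I) : E → E) =ᶠ[𝓝 p]
      fun a ↦ fderiv ℝ (fun b ↦ chartMul I G (a, b)) p u := by
    filter_upwards [extChartAt_target_mem_nhds (I := I) (1 : G)] with a ha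
    rw [fderiv_chartMul_right ha, mpullbackWithin_apply, inverse_mfderivWithin_extChartAt_symm ha]
    rfl
  have hp (u : E) : fderiv ℝ (fun b ↦ chartMul I G (p, b)) p u = u := by
    have : fderiv ℝ (fun b ↦ chartMul I G (p, b)) p = fderiv ℝ id p :=
      EventuallyEq.fderiv_eq (eventually_chartMul_one_left I G)
    simp [this]
  have hi : (mfderiv I 𝓘(ℝ, E) (extChartAt I (1 : G)) 1).inverse = ContinuousLinearMap.id ℝ E :=
    (congrArg (fun L : E →L[ℝ] E ↦ L.inverse) mfderiv_extChartAt_self).trans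
      ContinuousLinearMap.inverse_id
  have e1 : mlieBracket I (mulInvariantVectorField (I := I) (G := G) v)
      (mulInvariantVectorField (I := I) (G := G) w) 1 = lieBracketWithin ℝ
      (mpullbackWithin 𝓘(ℝ, E) I (extChartAt I (1 : G)).symm
        (mulInvariantVectorField (I := I) (G := G) v) (range I))
      (mpullbackWithin 𝓘(ℝ, E) I (extChartAt I (1 : G)).symm
        (mulInvariantVectorField (I := I) (G := G) w) (range I))
      ((extChartAt I (1 : G)).symm ⁻¹' univ ∩ range I) p :=
    congrArg (fun L : E →L[ℝ] E ↦ L (lieBracketWithin ℝ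
      (mpullbackWithin 𝓘(ℝ, E) I (extChartAt I (1 : G)).symm
        (mulInvariantVectorField (I := I) (G := G) v) (range I))
      (mpullbackWithin 𝓘(ℝ, E) I (extChartAt I (1 : G)).symm
        (mulInvariantVectorField (I := I) (G := G) w) (range I))
      ((extChartAt I (1 : G)).symm ⁻¹' univ ∩ range I) p)) hi
  have e2 : (extChartAt I (1 : G)).symm ⁻¹' univ ∩ range I = univ := by simp [I.range_eq_univ]
  have key (V' W' : E → E)
      (hV : V' =ᶠ[𝓝 p] fun a ↦ fderiv ℝ (fun b ↦ chartMul I G (a, b)) p v)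
      (hW : W' =ᶠ[𝓝 p] fun a ↦ fderiv ℝ (fun b ↦ chartMul I G (a, b)) p w) :
      lieBracketWithin ℝ V' W' ((extChartAt I (1 : G)).symm ⁻¹' univ ∩ range I) p =
        fderiv ℝ (fun a ↦ fderiv ℝ (fun b ↦ chartMul I G (a, b)) p w) p v -
        fderiv ℝ (fun a ↦ fderiv ℝ (fun b ↦ chartMul I G (a, b)) p v) p w := by
    rw [e2, lieBracketWithin_univ, hV.lieBracket_vectorField_eq hW, lieBracket_eq]
    simp only [hp]
  exact e1.trans (key _ _ (h v) (h w))

/-- The manifold derivative of a vector-valued function is the derivative in the chart. -/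
theorem hasFDerivAt_comp_extChartAt_symm {M F : Type*} [NormedAddCommGroup F] [NormedSpace ℝ F]
    [TopologicalSpace M] [ChartedSpace H M] {f : M → F} {x : M} {f' : E →L[ℝ] F}
    (hf : HasMFDerivAt I 𝓘(ℝ, F) f x f') :
    HasFDerivAt (f ∘ (extChartAt I x).symm) f' (extChartAt I x x) := by
  have h : HasFDerivWithinAt (f ∘ (extChartAt I x).symm) f' (range I) (extChartAt I x x) := hf.2
  rwa [I.range_eq_univ, hasFDerivWithinAt_univ] at h

/-- Left translation is right translation after `Ad`; in the chart this is the hypothesis `hAμ` of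
`fderiv_adjoint_of_contDiffAt`, whose conclusion is the chart formula for the bracket. -/
theorem mfderiv_adOrbit_one_eq_mlieBracket (v w : E) :
    (mfderiv I 𝓘(ℝ, E) (adOrbit I (G := G) w) 1 v : E) =
      mlieBracket I (mulInvariantVectorField (I := I) (G := G) v)
        (mulInvariantVectorField (I := I) (G := G) w) 1 := by
  have hd : MDifferentiableAt I 𝓘(ℝ, E) (adOrbit I (G := G) w) 1 :=
    (contMDiff_adOrbit I w).mdifferentiable (by simp) 1
  obtain ⟨L, hL⟩ : ∃ L : E →L[ℝ] E, L = mfderiv I 𝓘(ℝ, E) (adOrbit I (G := G) w) 1 := ⟨_, rfl⟩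
  have hA : HasFDerivAt (adOrbit I (G := G) w ∘ (extChartAt I (1 : G)).symm) L
      (extChartAt I (1 : G) 1) :=
    hasFDerivAt_comp_extChartAt_symm (hL ▸ hd.hasMFDerivAt)
  have e : (mfderiv I 𝓘(ℝ, E) (adOrbit I (G := G) w) 1 v : E) = L v := by rw [hL]; rfl
  rw [← hA.fderiv] at e
  refine e.trans ((fderiv_adjoint_of_contDiffAt ((contDiffAt_chartMul I G).of_le
    (ENat.LEInfty.out : (2 : ℕ∞ω) ≤ ∞))
    (eventually_chartMul_one_right I G) hA.differentiableAt w v ?_ ?_).trans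
    (mlieBracket_mulInvariantVectorField_one (G := G) (I := I) v w).symm)
  · simp only [Function.comp, extChartAt_to_inv, adOrbit, Ad_one]
    rfl
  · filter_upwards [extChartAt_target_mem_nhds (I := I) (1 : G)] with a ha
    rw [fderiv_chartMul_right ha, fderiv_chartMul_left ha]
    exact congrArg (mfderiv I 𝓘(ℝ, E) (extChartAt I (1 : G)) ((extChartAt I (1 : G)).symm a))
      (mulInvariantVectorField_eq_mfderiv_mul_right _ w)

/-- The differential of the adjoint representation is the Lie bracket. -/
theorem mfderiv_adOrbit_one (v w : GroupLieAlgebra I G) :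
    (mfderiv I 𝓘(ℝ, E) (adOrbit I (G := G) w) 1 v : E) = (⁅v, w⁆ : GroupLieAlgebra I G) :=
  mfderiv_adOrbit_one_eq_mlieBracket (I := I) (G := G) v w

end
end PeriodicTracking

/-! ### The invariant inner product and the maxima of `V`. -/

namespace PeriodicTracking

/-- The trace of an isometry of a positive definite bilinear form is at most the dimension. -/
theorem trace_le_finrank_of_isometry {M : Type*} [AddCommGroup M] [Module ℝ M]
    [FiniteDimensional ℝ M] {B : LinearMap.BilinForm ℝ M} (hs : ∀ u v, B u v = B v u)
    (hpos : ∀ u, u ≠ 0 → 0 < B u u) (f : M →ₗ[ℝ] M) (hf : ∀ u, B (f u) (f u) = B u u) :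
    LinearMap.trace ℝ M f ≤ finrank ℝ M := by
  obtain ⟨b, hb⟩ := LinearMap.BilinForm.exists_orthogonal_basis (B := B) ⟨fun u v ↦ by simp [hs u v]⟩
  have hbb (i) : 0 < B (b i) (b i) := hpos _ (b.ne_zero i)
  rw [LinearMap.trace_eq_matrix_trace ℝ b, Matrix.trace]
  have h (i) : (LinearMap.toMatrix b b f).diag i ≤ 1 := by
    rw [Matrix.diag_apply, LinearMap.toMatrix_apply]
    have h1 : B (b i) (f (b i)) = b.repr (f (b i)) i * B (b i) (b i) := by
      conv_lhs => rw [← b.sum_repr (f (b i))]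
      rw [map_sum, Finset.sum_eq_single i]
      · simp
      · intro j _ hj
        have : B (b i) (b j) = 0 := hb hj.symm
        simp [this]
      · simp
    -- Since `f` is an isometry, the right side is `2 * B (b i) (b i)` times one minus the diagonal
    -- entry.
    have h2 : 0 ≤ B (b i - f (b i)) (b i - f (b i)) := by
      rcases eq_or_ne (b i - f (b i)) 0 with h | h
      · simp [h]
      · exact (hpos _ h).le
    simp only [map_sub, LinearMap.sub_apply, hf, hs (f (b i)) (b i), h1] at h2
    nlinarith [hbb i]
  calc _ ≤ ∑ _i : Fin (finrank ℝ M), (1 : ℝ) := Finset.sum_le_sum fun i _ ↦ h i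
    _ = _ := by simp

section

variable {E : Type*} [NormedAddCommGroup E] [NormedSpace ℝ E] [FiniteDimensional ℝ E]
  {H : Type*} [TopologicalSpace H] {I : ModelWithCorners ℝ E H}
  {G : Type*} [TopologicalSpace G] [ChartedSpace H G] [Group G] [LieGroup I ∞ G]

instance finiteDimensional_groupLieAlgebra : FiniteDimensional ℝ (GroupLieAlgebra I G) :=
  inferInstanceAs (FiniteDimensional ℝ E)

variable (I G) in
/-- The Lie algebra of a compact Lie group has an `Ad`-invariant inner product. -/
theorem exists_Ad_invariant_form [CompactSpace G] :
    ∃ B : LinearMap.BilinForm ℝ (GroupLieAlgebra I G), (∀ u v, B u v = B v u) ∧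
      (∀ u, u ≠ 0 → 0 < B u u) ∧ ∀ (x : G) u v, B (Ad I x u) (Ad I x v) = B u v := by
  have : IsTopologicalGroup G := topologicalGroup_of_lieGroup I ∞
  borelize G
  let e : E ≃L[ℝ] EuclideanSpace ℝ (Fin (finrank ℝ E)) := toEuclidean
  let μ : Measure G := Measure.haar
  -- The norm of `E` need not come from an inner product, hence `e`. The inverse turns `Ad y` into
  -- left translation by `y⁻¹`, matching the left invariance of Haar measure.
  let T (u : GroupLieAlgebra I G) (x : G) : EuclideanSpace ℝ (Fin (finrank ℝ E)) :=
    e (adOrbit I u x⁻¹)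
  have hc (u) : Continuous (T u) :=
    e.continuous.comp ((contMDiff_adOrbit I u).continuous.comp continuous_inv)
  have hi (u v) : Integrable (fun x ↦ inner ℝ (T u x) (T v x)) μ :=
    ((hc u).inner (hc v)).integrable_of_hasCompactSupport (HasCompactSupport.of_compactSpace _)
  have hadd (u v x) : T (u + v) x = T u x + T v x :=
    (congrArg e ((Ad I x⁻¹).map_add u v)).trans (e.map_add _ _)
  have hsmul (c : ℝ) (u x) : T (c • u) x = c • T u x :=
    (congrArg e ((Ad I x⁻¹).map_smul c u)).trans (e.map_smul _ _)
  let B : LinearMap.BilinForm ℝ (GroupLieAlgebra I G) :=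
    LinearMap.mk₂ ℝ (fun u v ↦ ∫ x, inner ℝ (T u x) (T v x) ∂μ)
      (fun u u' v ↦ by simp only [hadd, inner_add_left, integral_add (hi _ _) (hi _ _)])
      (fun c u v ↦ by simp only [hsmul, inner_smul_left, integral_const_mul]; simp)
      (fun u v v' ↦ by simp only [hadd, inner_add_right, integral_add (hi _ _) (hi _ _)])
      (fun c u v ↦ by simp only [hsmul, inner_smul_right, integral_const_mul]; simp)
  have hB (u v) : B u v = ∫ x, inner ℝ (T u x) (T v x) ∂μ := rfl
  refine ⟨B, fun u v ↦ ?_, fun u hu ↦ ?_, fun y u v ↦ ?_⟩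
  · simp only [hB, real_inner_comm]
  · rw [hB]
    refine Continuous.integral_pos_of_hasCompactSupport_nonneg_nonzero (x := 1)
      ((hc u).inner (hc u)) (HasCompactSupport.of_compactSpace _) (fun x ↦ real_inner_self_nonneg) ?_
    intro h
    rw [inner_self_eq_zero] at h
    have h' : adOrbit I u (1 : G)⁻¹ = 0 := e.map_eq_zero_iff.1 h
    apply hu
    simp only [adOrbit, inv_one, Ad_one] at h'
    exact h'
  · rw [hB, hB, ← integral_mul_left_eq_self (fun x ↦ inner ℝ (T u x) (T v x)) y⁻¹]
    have h (u x) : T (Ad I y u) x = T u (y⁻¹ * x) := by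
      have := Ad_mul_apply I x⁻¹ y u
      have h2 : (y⁻¹ * x)⁻¹ = x⁻¹ * y := by group
      simp only [T, adOrbit, h2]
      rw [this]
    simp only [h]

/-- On a compact Lie group `V` is at most the dimension. -/
theorem V_le_finrank [CompactSpace G] (x : G) : V I x ≤ finrank ℝ (GroupLieAlgebra I G) := by
  obtain ⟨B, hs, hpos, hinv⟩ := exists_Ad_invariant_form I G
  exact trace_le_finrank_of_isometry hs hpos _ fun u ↦ hinv x u u

/-- An element with trivial adjoint map is a critical point of `W`. -/
theorem isCriticalPoint_W_of_Ad_eq_id [CompactSpace G] [I.Boundaryless] {m : ℕ}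
    (X : Fin m → GroupLieAlgebra I G) (xr : ℝ → G) {w : G} (hw : ∀ u, Ad I w u = u) :
    IsCriticalPoint (W X xr) w := by
  have hV : V I w = finrank ℝ (GroupLieAlgebra I G) := by
    have : (Ad I w : GroupLieAlgebra I G →ₗ[ℝ] GroupLieAlgebra I G) = LinearMap.id :=
      LinearMap.ext hw
    rw [V, this, LinearMap.trace_id]
  have hd : mfderiv I 𝓘(ℝ, ℝ) (V I : G → ℝ) w = 0 := by
    -- Where `V` is not differentiable, `mfderiv` is zero by convention, so smoothness of `V` need
    -- not be established.
    by_cases h : MDifferentiableAt I 𝓘(ℝ, ℝ) (V I : G → ℝ) w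
    · have hloc : IsLocalMax ((V I : G → ℝ) ∘ (extChartAt I w).symm) (extChartAt I w w) := by
        refine Eventually.of_forall fun a ↦ ?_
        simp only [Function.comp, extChartAt_to_inv, hV]
        exact V_le_finrank _
      exact hloc.hasFDerivAt_eq_zero (hasFDerivAt_comp_extChartAt_symm h.hasMFDerivAt)
    · exact mfderiv_zero_of_not_mdifferentiableAt h
  intro t
  refine Finset.sum_eq_zero fun k _ ↦ ?_
  have ha : a X xr k t w = 0 := by
    rw [a, mvfderiv, hd, ContinuousLinearMap.comp_zero]
    rfl
  rw [ha, zero_smul]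

omit [FiniteDimensional ℝ E] [LieGroup I ∞ G] in
/-- Central elements have trivial adjoint map. -/
theorem Ad_apply_of_mem_center {w : G} (hw : w ∈ Subgroup.center G) (u : GroupLieAlgebra I G) :
    Ad I w u = u := by
  have : (fun y : G ↦ w * y * w⁻¹) = id := by
    ext y
    rw [← Subgroup.mem_center_iff.1 hw y]
    simp
  rw [Ad, this, mfderiv_id]
  rfl

end
end PeriodicTracking

/-! ### Central directions, isolated critical points and semisimplicity. -/

namespace PeriodicTracking
section

variable {E : Type*} [NormedAddCommGroup E] [NormedSpace ℝ E]
  {H : Type*} [TopologicalSpace H] {I : ModelWithCorners ℝ E H} [I.Boundaryless]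
  {G : Type*} [TopologicalSpace G] [ChartedSpace H G] [Group G] [LieGroup I ∞ G]

/-- An `Ad`-invariant bilinear form is invariant under the Lie bracket. -/
theorem form_bracket_of_Ad_invariant [FiniteDimensional ℝ E]
    {B : LinearMap.BilinForm ℝ (GroupLieAlgebra I G)}
    (hB : ∀ (x : G) u v, B (Ad I x u) (Ad I x v) = B u v) (x y z : GroupLieAlgebra I G) :
    B ⁅x, y⁆ z = -B y ⁅x, z⁆ := by
  obtain ⟨C, hC⟩ : ∃ C : E →L[ℝ] E →L[ℝ] ℝ, ∀ u v, C u v = B u v :=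
    ⟨LinearMap.toContinuousLinearMap (LinearMap.toContinuousLinearMap.toLinearMap ∘ₗ
      (show E →ₗ[ℝ] E →ₗ[ℝ] ℝ from B)), fun u v ↦ rfl⟩
  have hA (w : GroupLieAlgebra I G) : ∃ L : E →L[ℝ] E,
      HasFDerivAt (adOrbit I (G := G) w ∘ (extChartAt I (1 : G)).symm) L (extChartAt I (1 : G) 1) ∧
      ∀ v : GroupLieAlgebra I G, L v = (⁅v, w⁆ : GroupLieAlgebra I G) := by
    have hd : MDifferentiableAt I 𝓘(ℝ, E) (adOrbit I (G := G) w) 1 :=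
      (contMDiff_adOrbit I w).mdifferentiable (by simp) 1
    exact ⟨mfderiv I 𝓘(ℝ, E) (adOrbit I (G := G) w) 1,
      hasFDerivAt_comp_extChartAt_symm hd.hasMFDerivAt, fun v ↦ mfderiv_adOrbit_one v w⟩
  obtain ⟨L, hL, hL'⟩ := hA y
  obtain ⟨K, hK, hK'⟩ := hA z
  -- The product rule at the identity for `B (Ad a y) (Ad a z)`, which is constant in `a`.
  have h1 := C.hasFDerivAt_of_bilinear hL hK
  have h2 : (fun a ↦ C ((adOrbit I (G := G) y ∘ (extChartAt I (1 : G)).symm) a)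
      ((adOrbit I (G := G) z ∘ (extChartAt I (1 : G)).symm) a)) = fun _ ↦ B y z := by
    ext a
    rw [hC]
    exact hB _ _ _
  rw [h2] at h1
  have h3 := congrArg (fun L : E →L[ℝ] ℝ ↦ L x) (h1.unique (hasFDerivAt_const _ _))
  have hone (w : GroupLieAlgebra I G) :
      (adOrbit I (G := G) w ∘ (extChartAt I (1 : G)).symm) (extChartAt I (1 : G) 1) = w := by
    simp only [Function.comp, extChartAt_to_inv, adOrbit, Ad_one]
    rfl
  simp only [hone] at h3
  have h4 : C y (K x) + C (L x) z = 0 := h3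
  have h5 : C y (K x) = B y ⁅x, z⁆ := (congrArg (C y) (hK' x)).trans (hC _ _)
  have h6 : C (L x) z = B ⁅x, y⁆ z := (congrArg (fun u : E ↦ C u z) (hL' x)).trans (hC _ _)
  linarith

/-- The derivative of the adjoint representation along a left-invariant vector field. -/
theorem mfderiv_adOrbit_mulInvariantVectorField (x : G) (v w : GroupLieAlgebra I G) :
    (mfderiv I 𝓘(ℝ, E) (adOrbit I (G := G) w) x (mulInvariantVectorField v x) : E) =
      Ad I x ⁅v, w⁆ := by
  obtain ⟨A, hA⟩ : ∃ A : E →L[ℝ] E, ∀ u, A u = Ad I x u := ⟨Ad I x, fun _ ↦ rfl⟩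
  have hd (y : G) : MDifferentiableAt I 𝓘(ℝ, E) (adOrbit I (G := G) w) y :=
    (contMDiff_adOrbit I w).mdifferentiable (by simp) y
  -- Multiplicativity of `Ad` moves the derivative from `x` to the identity, where it is the
  -- bracket.
  have h : adOrbit I (G := G) w ∘ (fun y ↦ x * y) = A ∘ adOrbit I w := by
    ext y
    exact (Ad_mul_apply I x y w).trans (hA _).symm
  have h1 := mfderiv_comp_apply_of_eq (x := (1 : G)) (hd x) (mdifferentiableAt_mul_left x 1)
    (mul_one x) v
  have h2 := mfderiv_comp_apply_of_eq (I' := 𝓘(ℝ, E)) (x := (1 : G))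
    A.differentiableAt.mdifferentiableAt (hd 1) rfl v
  rw [h] at h1
  refine (h1.symm.trans h2).trans ?_
  rw [mfderiv_eq_fderiv, A.fderiv, mfderiv_adOrbit_one]
  exact hA _

/-- The derivative of `Ad (γ t) w` is `Ad (γ t) ⁅z, w⁆ = 0`, so this vector keeps its value `w` from
time `0`. -/
theorem Ad_eq_id_along_integralCurve {z : GroupLieAlgebra I G}
    (hz : ∀ w : GroupLieAlgebra I G, ⁅z, w⁆ = 0) {γ : ℝ → G} (h0 : γ 0 = 1)
    (hγ : IsMIntegralCurveAt γ (mulInvariantVectorField z) 0) :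
    ∀ᶠ t in 𝓝 0, ∀ w, Ad I (γ t) w = w := by
  obtain ⟨ε, hε, h⟩ := Metric.eventually_nhds_iff_ball.1 hγ
  filter_upwards [Metric.ball_mem_nhds 0 hε] with t ht w
  have hd (s) (hs : s ∈ Metric.ball (0 : ℝ) ε) : HasDerivAt (adOrbit I (G := G) w ∘ γ) 0 s := by
    have hw : MDifferentiableAt I 𝓘(ℝ, E) (adOrbit I (G := G) w) (γ s) :=
      (contMDiff_adOrbit I w).mdifferentiable (by simp) (γ s)
    have h1 := hw.hasMFDerivAt.comp s (h s hs)
    have h2 := mfderiv_adOrbit_mulInvariantVectorField (I := I) (γ s) z w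
    rw [hz, map_zero] at h2
    have h3 : HasFDerivAt (adOrbit I (G := G) w ∘ γ) (0 : ℝ →L[ℝ] E) s := by
      refine hasMFDerivAt_iff_hasFDerivAt.1 (h1.congr_mfderiv ?_)
      ext
      refine Eq.trans ?_ h2
      refine congrArg (mfderiv I 𝓘(ℝ, E) (adOrbit I (G := G) w) (γ s)) ?_
      exact one_smul ℝ (mulInvariantVectorField z (γ s))
    simpa using h3.hasDerivAt
  have hc := (convex_ball (0 : ℝ) ε).is_const_of_fderivWithin_eq_zero (𝕜 := ℝ)
    (f := adOrbit I (G := G) w ∘ γ)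
    (fun s hs ↦ (hd s hs).differentiableAt.differentiableWithinAt)
    (fun s hs ↦ by
      rw [fderivWithin_of_isOpen Metric.isOpen_ball hs]
      simpa using (hd s hs).hasFDerivAt.fderiv) ht (Metric.mem_ball_self hε)
  simp only [Function.comp, h0, adOrbit, Ad_one] at hc
  exact hc

omit [I.Boundaryless] [LieGroup I ∞ G] in
-- Otherwise `γ` would be constant near `0`, although its velocity there is `z ≠ 0`.
theorem frequently_ne_one_integralCurve {z : GroupLieAlgebra I G} (hz : z ≠ 0) {γ : ℝ → G}
    (h0 : γ 0 = 1) (hγ : IsMIntegralCurveAt γ (mulInvariantVectorField z) 0) :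
    ∃ᶠ t in 𝓝 0, γ t ≠ 1 := by
  intro h
  simp only [not_not] at h
  have h1 := hγ.self_of_nhds
  have h2 : HasMFDerivAt 𝓘(ℝ, ℝ) I γ 0 0 := by
    refine (hasMFDerivAt_const (1 : G) (0 : ℝ)).congr_of_eventuallyEq h
  have h3 := congrArg (fun L : ℝ →L[ℝ] E ↦ L 1) (hasMFDerivAt_unique h1 h2)
  have h4 : (mulInvariantVectorField z (γ 0) : E) = 0 := (one_smul ℝ _).symm.trans h3
  rw [h0] at h4
  refine hz (Eq.trans ?_ h4)
  have e : (fun x : G ↦ 1 * x) = id := by ext; simp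
  rw [mulInvariantVectorField, e]
  exact (congrArg (fun L : E →L[ℝ] E ↦ L z) mfderiv_id).symm

/-- A Lie algebra with a positive definite invariant form and trivial center is semisimple. -/
theorem isSemisimple_of_invariant_form {L : Type*} [LieRing L] [LieAlgebra ℝ L]
    [FiniteDimensional ℝ L] {B : LinearMap.BilinForm ℝ L} (hs : ∀ u v, B u v = B v u)
    (hpos : ∀ u, u ≠ 0 → 0 < B u u) (hinv : ∀ x y z : L, B ⁅x, y⁆ z = -B y ⁅x, z⁆)
    (hZ : ∀ z : L, (∀ w : L, ⁅z, w⁆ = 0) → z = 0) : LieAlgebra.IsSemisimple ℝ L := by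
  refine LieAlgebra.InvariantForm.isSemisimple_of_nondegenerate B ?_ hinv ?_ ?_
  · refine ⟨fun u h ↦ ?_, fun u h ↦ ?_⟩ <;>
      exact by_contra fun hu ↦ (hpos u hu).ne' (h u)
  · intro x y h
    rw [hs, h]
  · intro J hJ hab
    -- An abelian ideal is central: for `z` in it, `⁅z, w⁆` lies in it too, so `⁅z, ⁅z, w⁆⁆ = 0` and
    -- invariance gives `B ⁅z, w⁆ ⁅z, w⁆ = 0`.
    refine hJ.1 ((LieSubmodule.eq_bot_iff _).2 fun z hz ↦ hZ z fun w ↦ ?_)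
    have hzw : ⁅z, w⁆ ∈ J := lie_mem_left ℝ L J z w hz
    by_contra hne
    have h := hpos _ hne
    have h0 : ⁅z, ⁅z, w⁆⁆ = 0 := by
      have := hab.trivial (⟨z, hz⟩ : J) ⟨_, hzw⟩
      exact congrArg Subtype.val this
    rw [hinv, h0] at h
    simp at h

/-- On a compact group with center of positive dimension there are points arbitrarily close to the
identity, other than the identity, with trivial adjoint map. -/
theorem exists_ne_one_Ad_eq_id [CompleteSpace E] {z : GroupLieAlgebra I G} (hz : z ≠ 0)
    (hc : ∀ w : GroupLieAlgebra I G, ⁅z, w⁆ = 0) {U : Set G} (hU : U ∈ 𝓝 (1 : G)) :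
    ∃ g ∈ U, g ≠ 1 ∧ ∀ w, Ad I g w = w := by
  have : IsManifold I 1 G := .of_le (n := ∞) (by simp)
  obtain ⟨γ, h0, hγ⟩ := exists_isMIntegralCurveAt_of_contMDiffAt_boundaryless (I := I) (t₀ := 0)
    ((contMDiffAt_mulInvariantVectorField (g := (1 : G)) z).of_le (by simp))
  have hcont : ContinuousAt γ 0 := hγ.self_of_nhds.continuousAt
  have hU' : ∀ᶠ t in 𝓝 0, γ t ∈ U := hcont.eventually_mem (by rwa [h0])
  obtain ⟨t, h1, h2, h3⟩ := ((frequently_ne_one_integralCurve hz h0 hγ).and_eventually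
    (hU'.and (Ad_eq_id_along_integralCurve hc h0 hγ))).exists
  exact ⟨γ t, h2, h1, h3⟩

omit [I.Boundaryless] in
/-- A local attractor is isolated among the critical points. -/
theorem IsLocalAttractor.exists_nhds_forall_isCriticalPoint_eq {M : Type*} [TopologicalSpace M]
    [ChartedSpace H M] [T2Space M] {Y : ℝ → (x : M) → TangentSpace I x} {w : M}
    (h : IsLocalAttractor Y w) : ∃ U ∈ 𝓝 w, ∀ y ∈ U, IsCriticalPoint Y y → y = w := by
  obtain ⟨-, U, hU, h⟩ := h
  refine ⟨U, hU, fun y hy hc ↦ ?_⟩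
  have hconst : IsIntegralCurve (fun _ : ℝ ↦ y) Y := by
    intro t
    rw [hc t, ContinuousLinearMap.smulRight_zero]
    exact hasMFDerivAt_const y t
  exact tendsto_nhds_unique tendsto_const_nhds (h 0 y hy _ hconst rfl)

end
end PeriodicTracking

theorem mainTheorem5
    {E : Type*} [NormedAddCommGroup E] [NormedSpace ℝ E] [FiniteDimensional ℝ E]
    [CompleteSpace E]
    {H : Type*} [TopologicalSpace H] (I : ModelWithCorners ℝ E H) [I.Boundaryless]
    {G : Type*} [TopologicalSpace G] [ChartedSpace H G] [Group G] [LieGroup I ∞ G]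
    [T2Space G] [CompactSpace G] [ConnectedSpace G]
    {m : ℕ} (X : Fin m → GroupLieAlgebra I G) (hX : PeriodicTracking.IsBracketGenerating X)
    (T : ℝ) (xr : ℝ → G) (ur : Fin m → ℝ → ℝ)
    (hr : PeriodicTracking.IsPeriodicTrajectory X T xr ur) :
    (∀ w ∈ Subgroup.center G, PeriodicTracking.IsCriticalPoint (PeriodicTracking.W X xr) w) ∧
    (PeriodicTracking.IsLocalAttractor (PeriodicTracking.W X xr) (1 : G) →
      LieAlgebra.IsSemisimple ℝ (GroupLieAlgebra I G)) := by
  refine ⟨fun w hw ↦ PeriodicTracking.isCriticalPoint_W_of_Ad_eq_id X xr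
    (PeriodicTracking.Ad_apply_of_mem_center hw), fun hatt ↦ ?_⟩
  obtain ⟨B, hs, hpos, hinv⟩ := PeriodicTracking.exists_Ad_invariant_form I G
  refine PeriodicTracking.isSemisimple_of_invariant_form hs hpos
    (PeriodicTracking.form_bracket_of_Ad_invariant hinv) fun z hz ↦ ?_
  by_contra hne
  obtain ⟨U, hU, h⟩ := hatt.exists_nhds_forall_isCriticalPoint_eq
  obtain ⟨g, hgU, hg, hAd⟩ := PeriodicTracking.exists_ne_one_Ad_eq_id hne hz hU
  exact hg (h g hgU (PeriodicTracking.isCriticalPoint_W_of_Ad_eq_id X xr hAd))
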